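/- **Setting.** Let $r\ge 1$ and let $\mathbf m=(m_1,\dots,m_r)\in\mathbb Z^r$ be a Motzkin path, i.e. $|m_\alpha-m_{\alpha+1}|\le 1$ for $1\le\alpha<r$. Let $K$ be a field, $t$ a formal variable, and $y_1,\dots,y_{2r+1}\in K$ skeleton weights with $y_{2j-1}\neq 0$ for $2\le j\le r$. **The graph $\Gamma_{\mathbf m}$.** It has $2r+2$ vertices, arranged in $r+1$ consecutive pairs $(J^-,J^+)$, $J=1,\dots,r+1$. The root $0$ is $1^-$ and the vertex $1$ is $1^+$. Call the pair $J$ *vertical* if $2\le J\le r$ and $m_J=m_{J-1}+1$, and *horizontal* otherwise. Put $J^*=J^+$ if $J=1$ or $J$ is vertical, and $J^*=J^-$ otherwise. The weighted oriented edges are: * $J^-\to J^+$ with weight $1$ and $J^+\to J^-$ with weight $t\,y_{2J-1}$, for $1\le J\le r+1$; * $J^*\to (J+1)^-$ with weight $1$ and $(J+1)^-\to J^*$ with weight $t\,y_{2J}$, for $1\le J\le r$; * $P^-\to Q^*$ with weight $t\,\dfrac{\prod_{j=Q}^{P-1}y_{2j}}{\prod_{j=Q+1}^{P-1}y_{2j-1}}$,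 for all $1\le Q$, $Q+2\le P\le r+1$ such that $m_{\alpha+1}=m_\alpha-1$ for $Q\le\alpha\le P-2$. (Equivalently, $\Gamma_{\mathbf m}$ is glued from one piece for each maximal descending segment of $\mathbf m$, along an edge which is horizontal or vertical according to whether the step of $\mathbf m$ between the two segments is flat or ascending.) **The compactified graph $\Gamma'_{\mathbf m}$.** It has the $r+1$ vertices $1,\dots,r+1$ and is obtained from $\Gamma_{\mathbf m}$ by identifying $J^-$ and $J^+$ to a vertex $J$ for each $J$, replacing the two edges between $J^-$ and $J^+$ by a loop at $J$ whose weight $t\,y_{2J-1}$ is the product of their weights, keeping all the other edges with their weights, and adding an ascending edge $I\to J$ with weight $(-1)^{J-I-1}$ whenever $I+2\le J$ and all the pairs $k$ with $I<k<J$ are vertical. **Transfer matrices.** Let $T_{\mathbf m}$ and $T'_{\mathbf m}$, of sizes $(2r+2)\times(2r+2)$ and $(r+1)\times(r+1)$, be the matrices over $K[[t]]$ whose entry in row $b$ and column $a$ is the weight of the edge $a\to b$ of $\Gamma_{\mathbf m}$, respectively $\Gamma'_{\mathbf m}$ (and $0$ if there is no such edge). **Theorem.** The matrices $1-T_{\mathbf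 m}$ and $1-T'_{\mathbf m}$ are invertible over $K[[t]]$, and $$\big((1-T_{\mathbf m})^{-1}\big)_{1,1}=\big((1-T'_{\mathbf m})^{-1}\big)_{1,1},$$ where the index $1$ on the left is the vertex $1=1^+$ of $\Gamma_{\mathbf m}$. The two sides are the ($t$-adically convergent) generating functions $\sum_{n\ge0}\sum_{(v_0,\dots,v_n)}\prod_{i<n}\mathrm{wt}(v_i\to v_{i+1})$ of the weighted paths, of arbitrary length $n$, from vertex $1$ to vertex $1$ on $\Gamma_{\mathbf m}$ and on $\Gamma'_{\mathbf m}$ respectively, so these generating functions coincide. In particular this holds for the weights attached to the $A_r$ $Q$-system: let $R_{\alpha,n}\in K$ ($0\le\alpha\le r+1$, $n\in\mathbb Z$) satisfy $R_{\alpha,n+1}R_{\alpha,n-1}=R_{\alpha,n}^2+R_{\alpha+1,n}R_{\alpha-1,n}$ for $1\le\alpha\le r$ and $R_{0,n}=R_{r+1,n}=1$, with all $R_{\alpha,n}\ne0$. Put $\lambda_{\alpha,n}=R_{\alpha,n+1}/R_{\alpha,n}$ and $\mu_{\alpha,n}=R_{\alpha,n}/R_{\alpha-1,n}$, and take $$y_{2\alpha-1}=\frac{\lambda_{\alpha,m_\alpha}}{\lambda_{\alpha-1,m_{\alpha-1}}}\quad(1\le\alpha\le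 r+1),\qquad y_{2\alpha}=\frac{\mu_{\alpha+1,m_\alpha+1}}{\mu_{\alpha,m_\alpha}}\,c_\alpha\,d_\alpha\quad(1\le\alpha\le r),$$ where $c_\alpha=\lambda_{\alpha+1,m_{\alpha+1}}/\lambda_{\alpha+1,m_\alpha}$ if $m_\alpha=m_{\alpha+1}+1$ and $c_\alpha=1$ otherwise, and $d_\alpha=\lambda_{\alpha-1,m_\alpha}/\lambda_{\alpha-1,m_{\alpha-1}}$ if $m_{\alpha-1}=m_\alpha+1$ and $d_\alpha=1$ otherwise (the values of $m_0$ and $m_{r+1}$ are immaterial, since $\lambda_{0,n}=\lambda_{r+1,n}=1$). -/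

import Mathlib

/-! ### Weighted oriented graphs, paths and transfer matrices

A weighted oriented graph on a vertex set `V` is given by `w : V → V → A`, where `w a b` is the
weight of the oriented edge `a → b`, and `w a b = 0` means that there is no such edge. -/

/-- The transfer matrix: the entry in row `b` and column `a` is the weight of the edge `a → b`. -/
def transferMatrix {V A : Type*} (w : V → V → A) : Matrix V V A :=
  Matrix.of fun b a => w a b

/-- The partition function of the paths `(v₀, v₁, …, vₙ)` of length `n` from `a` to `b`: the sum
over these paths of the products of the weights of the edges that they traverse. -/
def pathPartition {V A : Type*} [Fintype V] [DecidableEq V] [CommSemiring A]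
    (w : V → V → A) (a b : V) (n : ℕ) : A :=
  ∑ v : Fin (n + 1) → V with v 0 = a ∧ v (Fin.last n) = b,
    ∏ i : Fin n, w (v i.castSucc) (v i.succ)

/-- `Z` is the generating function of all paths (of arbitrary length) from `a` to `b`: the series
`∑ₙ pathPartition w a b n` of formal power series converges to `Z`, i.e. each coefficient of its
partial sums is eventually equal to that of `Z`. -/
def IsPathGenFun {V K : Type*} [Fintype V] [DecidableEq V] [CommSemiring K]
    (w : V → V → PowerSeries K) (a b : V) (Z : PowerSeries K) : Prop :=
  ∀ N : ℕ, ∀ᶠ L : ℕ in Filter.atTop,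
    PowerSeries.coeff N (∑ n ∈ Finset.range L, pathPartition w a b n) = PowerSeries.coeff N Z

/-! ### Motzkin paths -/

/-- `(m 1, …, m r)` is a Motzkin path (the other values of `m` play no role). -/
def IsMotzkinPath (r : ℕ) (m : ℕ → ℤ) : Prop :=
  ∀ α : ℕ, 1 ≤ α → α + 1 ≤ r → |m α - m (α + 1)| ≤ 1

/-- `m a, m (a+1), …, m b` is descending (by one at every step), i.e. `a, …, b` belong to the same
maximal descending segment of the Motzkin path. -/
def IsDescending (m : ℕ → ℤ) (a b : ℕ) : Prop :=
  ∀ α : ℕ, a ≤ α → α + 1 ≤ b → m (α + 1) = m α - 1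

/-! ### The graph `Γ_m`

The `2r+2` vertices of `Γ_m`, in the order `i < i' < i+1` from the root upwards, are arranged in
`r+1` consecutive pairs `J = 1, …, r+1`, joined by the skeleton edges `1, 3, …, 2r+1`.  The vertex
`(j, false)` is the lower (first) one and `(j, true)` is the upper (second) one of the pair
`J = j + 1`.  Thus the root `0` is `(0, false)`, and the vertex `1` is `(0, true)`. -/

abbrev GammaVertex (r : ℕ) : Type := Fin (r + 1) × Bool

/-- The vertex labelled `1` of `Γ_m`. -/
def gammaOne (r : ℕ) : GammaVertex r := (0, true)

/-- The skeleton edge `2J-1`, joining the two vertices of the pair `J`, is vertical: it is the edge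
along which two consecutive descending segments, ending at `J-1` and starting at `J`, with
an ascending separation are glued.  All the other edges `2J-1` are horizontal: they are the edge
from `0` to `1`, the top edge, and the edges joining some `i` and `i'`. -/
def IsVerticalPair (r : ℕ) (m : ℕ → ℤ) (J : ℕ) : Prop :=
  2 ≤ J ∧ J ≤ r ∧ m J = m (J - 1) + 1

open Classical in
/-- The vertex of the pair `J` to which the skeleton edge `2J` (going up to the lower vertex of the
pair `J+1`) is attached: the vertex `1` if `J = 1`, the upper vertex if the pair is vertical, and
the unprimed vertex `i` if the pair is the horizontal pair `i, i'`. -/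
noncomputable def exitSide (r : ℕ) (m : ℕ → ℤ) (J : ℕ) : Bool :=
  if J = 1 ∨ IsVerticalPair r m J then true else false

/-- The weight of the extra down-pointing edge from (the lower vertex of) the pair `P` to (the exit
vertex of) the pair `Q`, in terms of the skeleton weights `y 1, …, y (2r+1)`. -/
def extraWeight {K : Type*} [Field K] (y : ℕ → K) (P Q : ℕ) : K :=
  (∏ j ∈ Finset.Ico Q P, y (2 * j)) / ∏ j ∈ Finset.Ioo Q P, y (2 * j - 1)

open Classical in
/-- The weighted graph `Γ_m` with skeleton weights `t y_1, …, t y_{2r+1}`, where `t` is the formal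
variable of the power series ring. The edges pointing away from the root have weight `1`. -/
noncomputable def gammaGraph {K : Type*} [Field K] (r : ℕ) (m : ℕ → ℤ) (y : ℕ → K)
    (u v : GammaVertex r) : PowerSeries K :=
  let I : ℕ := u.1 + 1
  let J : ℕ := v.1 + 1
  if I = J ∧ u.2 = false ∧ v.2 = true then
    -- skeleton edge `2I-1`, away from the root
    1
  else if I = J ∧ u.2 = true ∧ v.2 = false then
    -- skeleton edge `2I-1`, towards the root
    PowerSeries.X * PowerSeries.C (y (2 * I - 1))
  else if J = I + 1 ∧ u.2 = exitSide r m I ∧ v.2 = false then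
    -- skeleton edge `2I`, away from the root
    1
  else if I = J + 1 ∧ u.2 = false ∧ v.2 = exitSide r m J then
    -- skeleton edge `2J`, towards the root
    PowerSeries.X * PowerSeries.C (y (2 * J))
  else if J + 2 ≤ I ∧ IsDescending m J (I - 1) ∧ u.2 = false ∧ v.2 = exitSide r m J then
    -- extra down-pointing edge inside the piece of a descending segment
    PowerSeries.X * PowerSeries.C (extraWeight y I J)
  else 0

/-! ### The compactified graph `Γ'_m` -/

open Classical in
/-- The network of ascending edges which is added to a maximal vertical chain of `Γ_m` when its
vertical pairs are contracted: an edge `I → J` of weight `(-1)^(J-I-1)` whenever `I + 2 ≤ J`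
and all the pairs strictly between `I` and `J` are vertical. -/
noncomputable def ascendingWeight (A : Type*) [Ring A] (r : ℕ) (m : ℕ → ℤ) (I J : ℕ) : A :=
  if I + 2 ≤ J ∧ ∀ k : ℕ, I < k → k < J → IsVerticalPair r m k then (-1) ^ (J - I - 1) else 0

/-- The compactified graph `Γ'_m` on the vertices `1, …, r+1` (with `i : Fin (r+1)` standing for
the vertex `i + 1`), built from `Γ_m`: the two vertices of each pair are identified, the
double edge joining them becomes a loop weighted by the product of the two weights, the other edges
and their weights are kept, and the ascending edges of the vertical chains are added. -/
noncomputable def compactGraph {K : Type*} [Field K] (r : ℕ) (m : ℕ → ℤ) (y : ℕ → K)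
    (i j : Fin (r + 1)) : PowerSeries K :=
  if i = j then
    gammaGraph r m y (i, false) (i, true) * gammaGraph r m y (i, true) (i, false)
  else
    (∑ a : Bool, ∑ b : Bool, gammaGraph r m y (i, a) (j, b)) +
      ascendingWeight (PowerSeries K) r m (i + 1) (j + 1)

/-! ### The `Q`-system and the skeleton weights -/

/-- `R α n`, for `0 ≤ α ≤ r + 1` and `n : ℤ`, is a solution of the `A_r` `Q`-system. -/
structure IsQSystemSolution {K : Type*} [Field K] (r : ℕ) (R : ℕ → ℤ → K) : Prop where
  recursion : ∀ (α : ℕ) (n : ℤ), 1 ≤ α → α ≤ r →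
    R α (n + 1) * R α (n - 1) = R α n ^ 2 + R (α + 1) n * R (α - 1) n
  bottom : ∀ n : ℤ, R 0 n = 1
  top : ∀ n : ℤ, R (r + 1) n = 1

def lam {K : Type*} [Field K] (R : ℕ → ℤ → K) (α : ℕ) (n : ℤ) : K :=
  R α (n + 1) / R α n

def mu {K : Type*} [Field K] (R : ℕ → ℤ → K) (α : ℕ) (n : ℤ) : K :=
  R α n / R (α - 1) n

/-- The skeleton weight `y_{2α-1}(m)`, `α = 1, …, r+1`. -/
def oddWeight {K : Type*} [Field K] (R : ℕ → ℤ → K) (m : ℕ → ℤ) (α : ℕ) : K :=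
  lam R α (m α) / lam R (α - 1) (m (α - 1))

/-- The skeleton weight `y_{2α}(m)`, `α = 1, …, r`. -/
def evenWeight {K : Type*} [Field K] (R : ℕ → ℤ → K) (m : ℕ → ℤ) (α : ℕ) : K :=
  mu R (α + 1) (m α + 1) / mu R α (m α) *
    (if m α = m (α + 1) + 1 then lam R (α + 1) (m (α + 1)) / lam R (α + 1) (m α) else 1) *
    (if m (α - 1) = m α + 1 then lam R (α - 1) (m α) / lam R (α - 1) (m (α - 1)) else 1)

/-- The skeleton weights `y_1(m), …, y_{2r+1}(m)`. -/
def skeletonWeight {K : Type*} [Field K] (R : ℕ → ℤ → K) (m : ℕ → ℤ) (i : ℕ) : K :=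
  if i % 2 = 1 then oddWeight R m ((i + 1) / 2) else evenWeight R m (i / 2)

/-! ### Equality of path generating functions -/

/-- For the skeleton weights `y`: with `T` and `T'` the transfer matrices of `Γ_m` and `Γ'_m`, the
matrices `1 - T` and `1 - T'` are invertible over the formal power series in `t`, the entries
`(1,1)` of their inverses agree, and these entries are the generating functions of the paths from
the vertex `1` to itself on the two graphs. -/
def CompactificationPreservesPaths {K : Type*} [Field K] (r : ℕ) (m : ℕ → ℤ) (y : ℕ → K) : Prop :=
  IsUnit (1 - transferMatrix (gammaGraph r m y)) ∧
  IsUnit (1 - transferMatrix (compactGraph r m y)) ∧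
  (1 - transferMatrix (gammaGraph r m y))⁻¹ (gammaOne r) (gammaOne r) =
    (1 - transferMatrix (compactGraph r m y))⁻¹ 0 0 ∧
  IsPathGenFun (gammaGraph r m y) (gammaOne r) (gammaOne r)
    ((1 - transferMatrix (gammaGraph r m y))⁻¹ (gammaOne r) (gammaOne r)) ∧
  IsPathGenFun (compactGraph r m y) 0 0
    ((1 - transferMatrix (compactGraph r m y))⁻¹ 0 0)

/-!
Decomposing paths according to their last step, the generating functions of the paths from the
vertex `1` to the various vertices form a solution of a linear system; it is unique, and
the series converge, because at `t = 0` only the edges pointing away from the root survive, so that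
`T` and `T'` are nilpotent modulo `t`.

Eliminate the upper vertices from the system of `Γ_m`. On a vertical pair the edge to the next pair
leaves from the upper vertex, whose value `x⁺` satisfies `loop * x⁺ = x⁻ - arrival`, where `x⁻` is
the value at the lower vertex and `arrival` is the contribution of the previous pair. Iterating this
along a chain of vertical pairs gives the ascending edges with their alternating signs, provided
that the value at each pair is multiplied by the product of the loop weights of the vertical pairs
below it. Descending edges are compatible with this rescaling since none of them passes over a
vertical pair, and the factor at the vertex `1` is `1`.
-/

open Matrix PowerSeries

/-! ### Path generating functions and transfer matrices -/

theorem pathPartition_succ {V A : Type*} [Fintype V] [DecidableEq V] [CommSemiring A]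
    (w : V → V → A) (a b : V) (n : ℕ) :
    pathPartition w a b (n + 1) = ∑ c, w a c * pathPartition w c b n := by
  simp only [pathPartition, Finset.sum_filter, Finset.mul_sum]
  rw [← (Fin.consEquiv fun _ : Fin (n + 2) => V).sum_comp, Fintype.sum_prod_type_right]
  conv_rhs => rw [Finset.sum_comm]
  refine Finset.sum_congr rfl fun v _ => ?_
  simp [← Fin.succ_last, Fin.prod_univ_succ, Fin.consEquiv_apply, ite_and]

theorem transferMatrix_pow_apply {V A : Type*} [Fintype V] [DecidableEq V] [CommSemiring A]
    (w : V → V → A) (n : ℕ) (b a : V) :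
    (transferMatrix w ^ n) b a = pathPartition w a b n := by
  induction n generalizing a with
  | zero =>
    rw [pow_zero, one_apply, pathPartition, Finset.sum_filter,
      ← (Equiv.funUnique (Fin 1) V).symm.sum_comp]
    simp [ite_and, eq_comm]
  | succ n ih =>
    rw [pathPartition_succ, pow_succ, mul_apply]
    exact Finset.sum_congr rfl fun c _ => by rw [ih, mul_comm, transferMatrix, of_apply]

theorem isNilpotent_of_rank_lt {V A : Type*} [Fintype V] [DecidableEq V] [Semiring A]
    (M : Matrix V V A) (ρ : V → ℕ) (h : ∀ b a, M b a ≠ 0 → ρ a < ρ b) : IsNilpotent M := by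
  have key (n : ℕ) (b a : V) (hn : ρ b < ρ a + n) : (M ^ n) b a = 0 := by
    induction n generalizing a with
    | zero =>
      rw [pow_zero, one_apply_ne]
      rintro rfl
      exact hn.false
    | succ n ih =>
      rw [pow_succ, mul_apply]
      refine Finset.sum_eq_zero fun c _ => ?_
      by_cases hc : M c a = 0
      · rw [hc, mul_zero]
      · have := h c a hc
        rw [ih c (by omega), zero_mul]
  refine ⟨Finset.univ.sup ρ + 1, ?_⟩
  ext b a
  have : ρ b ≤ Finset.univ.sup ρ := Finset.le_sup (Finset.mem_univ b)
  exact key _ b a (by omega)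

section NilpotentConstantTerm

variable {V K : Type*} [Fintype V] [DecidableEq V] [CommRing K]

theorem isUnit_one_sub_of_isNilpotent_constantCoeff {M : Matrix V V K⟦X⟧}
    (hM : IsNilpotent (M.map (constantCoeff (R := K)))) : IsUnit (1 - M) := by
  rw [isUnit_iff_isUnit_det, PowerSeries.isUnit_iff_constantCoeff, RingHom.map_det,
    ← isUnit_iff_isUnit_det, map_sub, map_one]
  exact hM.isUnit_one_sub

theorem eventually_X_pow_dvd_pow_apply {M : Matrix V V K⟦X⟧}
    (hM : IsNilpotent (M.map (constantCoeff (R := K)))) (N : ℕ) :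
    ∀ᶠ n in Filter.atTop, ∀ b a, (X ^ N : K⟦X⟧) ∣ (M ^ n) b a := by
  obtain ⟨k, hk⟩ := hM
  rw [← Matrix.map_pow] at hk
  have hX (b a : V) : (X : K⟦X⟧) ∣ (M ^ k) b a := X_dvd_iff.2 (congrFun (congrFun hk b) a)
  choose B hB using hX
  have hkB : M ^ k = (X : K⟦X⟧) • of B := by
    ext1 b a
    exact hB b a
  filter_upwards [Filter.eventually_ge_atTop (k * N)] with n hn b a
  obtain ⟨l, rfl⟩ := Nat.exists_eq_add_of_le hn
  rw [pow_add, pow_mul, hkB, smul_pow, smul_mul]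
  exact dvd_mul_right _ _

theorem inv_one_sub_eq_geom_sum_add {A : Type*} [CommRing A] {M : Matrix V V A}
    (hM : IsUnit (1 - M)) (n : ℕ) :
    (1 - M)⁻¹ = ∑ i ∈ Finset.range n, M ^ i + (1 - M)⁻¹ * M ^ n := by
  have hdet := (isUnit_iff_isUnit_det _).1 hM
  rw [← nonsing_inv_mul_cancel_left (A := 1 - M) (∑ i ∈ Finset.range n, M ^ i) hdet,
    mul_neg_geom_sum, mul_sub, mul_one, sub_add_cancel]

theorem eventually_coeff_geom_sum_apply {M : Matrix V V K⟦X⟧}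
    (hM : IsNilpotent (M.map (constantCoeff (R := K)))) (N : ℕ) (b a : V) :
    ∀ᶠ n in Filter.atTop,
      coeff N ((∑ i ∈ Finset.range n, M ^ i) b a) = coeff N ((1 - M)⁻¹ b a) := by
  filter_upwards [eventually_X_pow_dvd_pow_apply hM (N + 1)] with n hn
  have hrest : (X ^ (N + 1) : K⟦X⟧) ∣ ((1 - M)⁻¹ * M ^ n) b a := by
    rw [mul_apply]
    exact Finset.dvd_sum fun c _ => (hn c a).mul_left _
  have hcoeff := X_pow_dvd_iff.1 hrest N N.lt_add_one
  have hunit := isUnit_one_sub_of_isNilpotent_constantCoeff hM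
  rw [← add_zero (coeff N _), ← hcoeff, ← map_add, ← Matrix.add_apply,
    ← inv_one_sub_eq_geom_sum_add hunit]

theorem isPathGenFun_inv_one_sub_transferMatrix {w : V → V → K⟦X⟧}
    (hw : IsNilpotent ((transferMatrix w).map (constantCoeff (R := K)))) (a b : V) :
    IsPathGenFun w a b ((1 - transferMatrix w)⁻¹ b a) := by
  intro N
  simpa only [Matrix.sum_apply, transferMatrix_pow_apply] using
    eventually_coeff_geom_sum_apply hw N b a

end NilpotentConstantTerm

section LastStep

variable {V A : Type*} [Fintype V] [DecidableEq V] [CommRing A]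

/-- `x` solves the linear system satisfied by the generating functions `x b` of the paths from `a`
to `b`, which comes from decomposing these paths according to their last step. -/
def IsLastStepSolution (w : V → V → A) (a : V) (x : V → A) : Prop :=
  ∀ b, x b = ∑ c, w c b * x c + if b = a then 1 else 0

theorem isLastStepSolution_iff_mulVec {w : V → V → A} {a : V} {x : V → A} :
    IsLastStepSolution w a x ↔ (1 - transferMatrix w) *ᵥ x = Pi.single a 1 := by
  simp only [IsLastStepSolution, sub_mulVec, one_mulVec, sub_eq_iff_eq_add', funext_iff,
    Pi.add_apply, Pi.single_apply, mulVec, dotProduct, transferMatrix, of_apply]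

theorem isLastStepSolution_iff {w : V → V → A} (hw : IsUnit (1 - transferMatrix w)) {a : V}
    {x : V → A} : IsLastStepSolution w a x ↔ x = (1 - transferMatrix w)⁻¹.col a := by
  have hdet := (isUnit_iff_isUnit_det _).1 hw
  rw [isLastStepSolution_iff_mulVec, ← mulVec_single_one]
  constructor
  · intro h
    rw [← h, mulVec_mulVec, nonsing_inv_mul _ hdet, one_mulVec]
  · rintro rfl
    rw [mulVec_mulVec, mul_nonsing_inv _ hdet, one_mulVec]

end LastStep

/-! ### Chains of pairs of vertices -/

/-- The data from which a graph of the type of `Γ_m` and its compactification are built, on pairs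
of vertices numbered from `0` (the pair `k` is the pair `J = k + 1` of `Γ_m`): the vertical pairs,
the weight of the edge of each pair towards the root, and the weights of the edges going down from
one pair to another. No descending edge passes over a vertical pair. -/
structure PairChain (A : Type*) [Zero A] where
  vertical : Set ℕ
  loop : ℕ → A
  down : ℕ → ℕ → A
  zero_notMem_vertical : 0 ∉ vertical
  down_of_le {p q : ℕ} : p ≤ q → down p q = 0
  down_of_mem_vertical {p q k : ℕ} : k ∈ vertical → q < k → k < p → down p q = 0

namespace PairChain

variable {A : Type*} [CommRing A] (G : PairChain A)

/-- The pairs that are joined to the other pairs by their upper vertex, except for the edges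
arriving from the previous pair and leaving towards the root: the root pair and the vertical
ones. -/
def upperExit : Set ℕ := insert 0 G.vertical

open Classical in
/-- The graph on the first `n + 1` pairs, whose lower and upper vertices are marked `false` and
`true`. -/
noncomputable def graph (n : ℕ) : Fin (n + 1) × Bool → Fin (n + 1) × Bool → A
  | (i, false), (j, true) =>
    (if i = j then 1 else 0) + if (j : ℕ) ∈ G.upperExit then G.down i j else 0
  | (i, true), (j, false) =>
    (if i = j then G.loop j else 0) + if (j : ℕ) = i + 1 ∧ (i : ℕ) ∈ G.upperExit then 1 else 0
  | (i, false), (j, false) =>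
    (if (j : ℕ) = i + 1 ∧ (i : ℕ) ∉ G.upperExit then 1 else 0) +
      if (j : ℕ) ∈ G.upperExit then 0 else G.down i j
  | (_, true), (_, true) => 0

open Classical in
/-- The weight of the ascending edge from the pair `i` to the pair `j` of the compactified graph.
The skeleton edges are included, as the case `j = i + 1`. -/
noncomputable def up (i j : ℕ) : A :=
  if i < j ∧ ∀ k, i < k → k < j → k ∈ G.vertical then (-1) ^ (j - i - 1) else 0

/-- The compactified graph on the first `n + 1` pairs. -/
noncomputable def compactification (n : ℕ) (i j : Fin (n + 1)) : A :=
  (if i = j then G.loop j else 0) + G.up i j + G.down i j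

theorem up_of_le {i j : ℕ} (h : j ≤ i) : G.up i j = 0 :=
  if_neg fun h' => h.not_gt h'.1

open Classical in
theorem up_succ (i j : ℕ) :
    G.up i (j + 1) = (if i = j then 1 else 0) - if j ∈ G.vertical then G.up i j else 0 := by
  rcases lt_trichotomy i j with hij | rfl | hij
  · have hchain : (∀ k, i < k → k < j + 1 → k ∈ G.vertical) ↔
        j ∈ G.vertical ∧ ∀ k, i < k → k < j → k ∈ G.vertical := by
      simp only [Nat.lt_succ_iff_lt_or_eq]
      grind
    obtain ⟨d, rfl⟩ := Nat.exists_eq_add_of_lt hij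
    simp only [up, hchain, hij, hij.ne, hij.trans (Nat.lt_succ_self _), true_and, ite_and,
      if_false, zero_sub]
    rw [show i + d + 1 + 1 - i - 1 = d + 1 by omega, show i + d + 1 - i - 1 = d by omega, pow_succ]
    split_ifs <;> simp
  · rw [up, if_pos ⟨by omega, by omega⟩, up_of_le G le_rfl]
    simp
  · rw [up_of_le G hij, up_of_le G hij.le, if_neg hij.ne']
    simp

open Classical in
/-- The product of the loop weights of the vertical pairs below the pair `j`: the factor by which
the solutions of the linear systems of the two graphs differ. -/
noncomputable def verticalLoops (j : ℕ) : A :=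
  ∏ k ∈ Finset.range j, if k ∈ G.vertical then G.loop k else 1

theorem verticalLoops_zero : G.verticalLoops 0 = 1 :=
  Finset.prod_range_zero _

theorem verticalLoops_succ_of_mem {j : ℕ} (hj : j ∈ G.vertical) :
    G.verticalLoops (j + 1) = G.verticalLoops j * G.loop j := by
  rw [verticalLoops, Finset.prod_range_succ, if_pos hj, ← verticalLoops]

theorem verticalLoops_succ_of_notMem {j : ℕ} (hj : j ∉ G.vertical) :
    G.verticalLoops (j + 1) = G.verticalLoops j := by
  rw [verticalLoops, Finset.prod_range_succ, if_neg hj, mul_one, ← verticalLoops]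

theorem down_mul_verticalLoops (p q : ℕ) :
    G.down p q * G.verticalLoops p = G.down p q * G.verticalLoops (q + 1) := by
  by_cases h : G.down p q = 0
  · rw [h, zero_mul, zero_mul]
  have hqp : q + 1 ≤ p := not_le.1 fun hpq => h (G.down_of_le hpq)
  rw [verticalLoops, ← Finset.prod_range_mul_prod_Ico _ hqp, Finset.prod_eq_one (s := .Ico _ _),
    mul_one, ← verticalLoops]
  intro k hk
  rw [Finset.mem_Ico] at hk
  exact if_neg fun hv => h (G.down_of_mem_vertical hv hk.1 hk.2)

section Solution

variable {G} {n : ℕ} {x : Fin (n + 1) × Bool → A}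

open Classical in
/-- The value of `x` at the vertex of the pair `i` from which the edge to the next pair leaves. -/
noncomputable def exitValue (G : PairChain A) (x : Fin (n + 1) × Bool → A) (i : Fin (n + 1)) : A :=
  if (i : ℕ) ∈ G.upperExit then x (i, true) else x (i, false)

/-- The contribution of the previous pair to the value of `x` at the lower vertex of the pair
`j`. -/
noncomputable def arrival (G : PairChain A) (x : Fin (n + 1) × Bool → A) (j : Fin (n + 1)) : A :=
  ∑ i : Fin (n + 1), if (j : ℕ) = i + 1 then G.exitValue x i else 0

/-- The contribution of the pairs above the pair `j` to the value of `x` on that pair. -/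
def descent (G : PairChain A) (x : Fin (n + 1) × Bool → A) (j : Fin (n + 1)) : A :=
  ∑ i : Fin (n + 1), G.down i j * x (i, false)

theorem arrival_zero : G.arrival x 0 = 0 :=
  Finset.sum_eq_zero fun i _ => if_neg (by simp)

theorem arrival_succ (i : Fin n) (x : Fin (n + 1) × Bool → A) :
    G.arrival x i.succ = G.exitValue x i.castSucc := by
  have h (k : Fin (n + 1)) : (i.succ : ℕ) = k + 1 ↔ i.castSucc = k := by
    simp [Fin.ext_iff]
  simp only [arrival, h, Finset.sum_ite_eq, Finset.mem_univ, if_true]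

open Classical in
theorem apply_upper (hx : IsLastStepSolution (G.graph n) (0, true) x) (j : Fin (n + 1)) :
    x (j, true) = x (j, false) + (if (j : ℕ) ∈ G.upperExit then G.descent x j else 0) +
      if j = 0 then 1 else 0 := by
  rw [hx (j, true), Fintype.sum_prod_type]
  simp only [Fintype.sum_bool, graph, zero_mul, zero_add, add_mul, Finset.sum_add_distrib,
    ite_mul, one_mul, Finset.sum_ite_eq', Finset.mem_univ, if_true, Prod.mk.injEq, and_true]
  split_ifs <;> simp [descent]

open Classical in
theorem apply_lower (hx : IsLastStepSolution (G.graph n) (0, true) x) (j : Fin (n + 1)) :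
    x (j, false) = G.loop j * x (j, true) + G.arrival x j +
      if (j : ℕ) ∈ G.upperExit then 0 else G.descent x j := by
  have hstep (i : Fin (n + 1)) : ∑ a, G.graph n (i, a) (j, false) * x (i, a) =
      (if i = j then G.loop j * x (i, true) else 0) +
        (if (j : ℕ) = i + 1 then G.exitValue x i else 0) +
        if (j : ℕ) ∈ G.upperExit then 0 else G.down i j * x (i, false) := by
    simp only [Fintype.sum_bool, graph, exitValue]
    grind
  conv_lhs => rw [hx (j, false), Fintype.sum_prod_type]
  simp only [hstep, Finset.sum_add_distrib, arrival, descent]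
  split_ifs <;> simp_all

/-- The solution of the linear system of the compactified graph that a solution `x` of the linear
system of the graph gives rise to. -/
noncomputable def compactSolution (G : PairChain A) (x : Fin (n + 1) × Bool → A)
    (j : Fin (n + 1)) : A :=
  G.verticalLoops j * if j = 0 then x (0, true) else x (j, false)

open Classical in
theorem verticalLoops_succ_mul_exitValue
    (hx : IsLastStepSolution (G.graph n) (0, true) x) (j : Fin (n + 1)) :
    G.verticalLoops (j + 1) * G.exitValue x j = G.compactSolution x j -
      if (j : ℕ) ∈ G.vertical then G.verticalLoops j * G.arrival x j else 0 := by
  have hlower := apply_lower hx j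
  by_cases hv : (j : ℕ) ∈ G.vertical
  · have hj : j ≠ 0 := by
      rintro rfl
      exact G.zero_notMem_vertical hv
    have hexit : (j : ℕ) ∈ G.upperExit := .inr hv
    rw [if_pos hexit] at hlower
    rw [G.verticalLoops_succ_of_mem hv, exitValue, if_pos hexit, compactSolution, if_neg hj,
      if_pos hv, hlower]
    ring
  · rw [G.verticalLoops_succ_of_notMem hv, if_neg hv, sub_zero, compactSolution, exitValue]
    by_cases hj : j = 0
    · subst hj
      simp [upperExit]
    · simp [upperExit, hv, hj]

theorem sum_up_mul_compactSolution (hx : IsLastStepSolution (G.graph n) (0, true) x)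
    (j : Fin (n + 1)) :
    ∑ i : Fin (n + 1), G.up i j * G.compactSolution x i = G.verticalLoops j * G.arrival x j := by
  induction j using Fin.induction with
  | zero =>
    rw [arrival_zero, mul_zero]
    exact Finset.sum_eq_zero fun i _ => by rw [G.up_of_le (by simp), zero_mul]
  | succ j ih =>
    have hsum : ∑ i : Fin (n + 1), (if i = j.castSucc then (1 : A) else 0) *
        G.compactSolution x i = G.compactSolution x j.castSucc := by
      simp
    have hval (i : Fin (n + 1)) : (i : ℕ) = (j.castSucc : ℕ) ↔ i = j.castSucc := Fin.val_inj
    rw [arrival_succ, Fin.val_succ, ← Fin.val_castSucc, verticalLoops_succ_mul_exitValue hx, ← ih]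
    simp only [up_succ, hval, sub_mul, Finset.sum_sub_distrib, hsum]
    split_ifs <;> simp

theorem sum_down_mul_compactSolution (j : Fin (n + 1)) (x : Fin (n + 1) × Bool → A) :
    ∑ i : Fin (n + 1), G.down i j * G.compactSolution x i =
      G.verticalLoops (j + 1) * G.descent x j := by
  rw [descent, Finset.mul_sum]
  refine Finset.sum_congr rfl fun i _ => ?_
  rw [compactSolution, ← mul_assoc, down_mul_verticalLoops]
  by_cases hi : i = 0
  · rw [G.down_of_le (by simp [hi])]
    ring
  · rw [if_neg hi]
    ring

theorem isLastStepSolution_compactSolution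
    (hx : IsLastStepSolution (G.graph n) (0, true) x) :
    IsLastStepSolution (G.compactification n) 0 (G.compactSolution x) := by
  intro j
  have hupper := apply_upper hx j
  have hlower := apply_lower hx j
  simp only [compactification, add_mul, Finset.sum_add_distrib, ite_mul, zero_mul,
    Finset.sum_ite_eq', Finset.mem_univ, if_true]
  rw [sum_up_mul_compactSolution hx, sum_down_mul_compactSolution, compactSolution]
  by_cases hj : j = 0
  · subst hj
    have hexit : ((0 : Fin (n + 1)) : ℕ) ∈ G.upperExit := .inl rfl
    rw [if_pos hexit] at hupper hlower
    rw [Fin.val_zero, G.verticalLoops_succ_of_notMem G.zero_notMem_vertical, verticalLoops_zero]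
    simp only [if_true, arrival_zero, Fin.val_zero] at hupper hlower ⊢
    linear_combination hupper + hlower
  have hj' : (j : ℕ) ≠ 0 := Fin.val_ne_zero_iff.2 hj
  by_cases hv : (j : ℕ) ∈ G.vertical
  · have hexit : (j : ℕ) ∈ G.upperExit := .inr hv
    rw [if_pos hexit, if_neg hj] at hupper
    rw [if_pos hexit] at hlower
    rw [G.verticalLoops_succ_of_mem hv, if_neg hj, if_neg hj]
    linear_combination G.verticalLoops j * (hlower + G.loop j * hupper)
  · have hexit : (j : ℕ) ∉ G.upperExit := fun h => h.elim hj' hv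
    rw [if_neg hexit, if_neg hj] at hupper
    rw [if_neg hexit] at hlower
    rw [G.verticalLoops_succ_of_notMem hv, if_neg hj, if_neg hj]
    linear_combination G.verticalLoops j * (hlower + G.loop j * hupper)

end Solution

theorem inv_one_sub_transferMatrix_graph_apply {n : ℕ}
    (hgraph : IsUnit (1 - transferMatrix (G.graph n)))
    (hcompact : IsUnit (1 - transferMatrix (G.compactification n))) :
    (1 - transferMatrix (G.graph n))⁻¹ (0, true) (0, true) =
      (1 - transferMatrix (G.compactification n))⁻¹ 0 0 := by
  have hx := (isLastStepSolution_iff hgraph (a := (0, true))).2 rfl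
  have hz := (isLastStepSolution_iff hcompact).1 (isLastStepSolution_compactSolution hx)
  simpa [compactSolution, verticalLoops_zero] using congrFun hz 0

section PowerSeries

variable {K : Type*} [CommRing K] (G : PairChain K⟦X⟧)
  (hloop : ∀ k, constantCoeff (G.loop k) = 0) (hdown : ∀ p q, constantCoeff (G.down p q) = 0)

include hloop hdown

theorem isNilpotent_constantCoeff_graph (n : ℕ) :
    IsNilpotent ((transferMatrix (G.graph n)).map (constantCoeff (R := K))) := by
  refine isNilpotent_of_rank_lt _ (fun v => 2 * (v.1 : ℕ) + v.2.toNat) ?_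
  rintro ⟨j, b⟩ ⟨i, a⟩ h
  contrapose! h
  cases a <;> cases b <;>
    simp only [Bool.toNat_false, Bool.toNat_true] at h <;>
    simp [transferMatrix, graph, apply_ite constantCoeff, hloop, hdown] <;> omega

theorem isNilpotent_constantCoeff_compactification (n : ℕ) :
    IsNilpotent ((transferMatrix (G.compactification n)).map (constantCoeff (R := K))) := by
  refine isNilpotent_of_rank_lt _ (fun i => (i : ℕ)) fun j i h => ?_
  contrapose! h
  simp [transferMatrix, compactification, up_of_le G h, apply_ite constantCoeff, hloop, hdown]

end PowerSeries

end PairChain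

/-! ### The chain of pairs of a Motzkin path -/

section Motzkin

variable {K : Type*} [Field K]

open Classical in
/-- The weight of the edge of `Γ_m` from the pair `P` down to the pair `Q`. The skeleton edges are
included: for `P = Q + 1` the condition is void and `extraWeight y P Q = y (2 * Q)`. -/
noncomputable def descendingWeight (m : ℕ → ℤ) (y : ℕ → K) (P Q : ℕ) : K⟦X⟧ :=
  if Q < P ∧ IsDescending m Q (P - 1) then X * C (extraWeight y P Q) else 0

theorem isDescending_self (m : ℕ → ℤ) (a : ℕ) : IsDescending m a a :=
  fun _ _ _ => by omega

theorem extraWeight_succ (y : ℕ → K) (Q : ℕ) : extraWeight y (Q + 1) Q = y (2 * Q) := by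
  have : Finset.Ioo Q (Q + 1) = ∅ := by
    ext
    simp
  simp [extraWeight, this]

theorem IsVerticalPair.not_isDescending {r : ℕ} {m : ℕ → ℤ} {a b k : ℕ}
    (hk : IsVerticalPair r m k) (ha : a < k) (hb : k ≤ b) : ¬ IsDescending m a b := by
  obtain ⟨j, rfl⟩ := Nat.exists_eq_add_of_lt ha
  intro h
  have hup := hk.2.2
  have hdown := h (a + j) (by omega) hb
  rw [Nat.add_sub_cancel] at hup
  omega

/-- The pair chain of `Γ_m`. -/
noncomputable def motzkinChain (r : ℕ) (m : ℕ → ℤ) (y : ℕ → K) : PairChain K⟦X⟧ where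
  vertical := {k | IsVerticalPair r m (k + 1)}
  loop k := X * C (y (2 * (k + 1) - 1))
  down p q := descendingWeight m y (p + 1) (q + 1)
  zero_notMem_vertical h := absurd h.1 (by omega)
  down_of_le h := if_neg fun h' => by omega
  down_of_mem_vertical hk hq hp := if_neg fun h =>
    IsVerticalPair.not_isDescending hk (by omega) (by omega) h.2

theorem loop_motzkinChain (r : ℕ) (m : ℕ → ℤ) (y : ℕ → K) (k : ℕ) :
    (motzkinChain r m y).loop k = X * C (y (2 * (k + 1) - 1)) :=
  rfl

open Classical in
theorem down_motzkinChain (r : ℕ) (m : ℕ → ℤ) (y : ℕ → K) (p q : ℕ) :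
    (motzkinChain r m y).down p q = if p = q + 1 then X * C (y (2 * (q + 1)))
      else if q + 2 ≤ p ∧ IsDescending m (q + 1) p then X * C (extraWeight y (p + 1) (q + 1))
      else 0 := by
  by_cases h : p = q + 1
  · subst h
    simp [motzkinChain, descendingWeight, isDescending_self, extraWeight_succ]
  · have hlt : q + 1 < p + 1 ↔ q + 2 ≤ p := by omega
    simp only [motzkinChain, descendingWeight, h, hlt, if_false, Nat.add_sub_cancel]

theorem constantCoeff_motzkinChain_loop (r : ℕ) (m : ℕ → ℤ) (y : ℕ → K) (k : ℕ) :
    constantCoeff ((motzkinChain r m y).loop k) = 0 := by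
  simp [loop_motzkinChain]

theorem constantCoeff_motzkinChain_down (r : ℕ) (m : ℕ → ℤ) (y : ℕ → K) (p q : ℕ) :
    constantCoeff ((motzkinChain r m y).down p q) = 0 := by
  rw [down_motzkinChain]
  split_ifs <;> simp

theorem mem_upperExit_motzkinChain {r : ℕ} {m : ℕ → ℤ} {y : ℕ → K} {k : ℕ} :
    k ∈ (motzkinChain r m y).upperExit ↔ exitSide r m (k + 1) = true := by
  simp [PairChain.upperExit, motzkinChain, exitSide]

theorem up_motzkinChain (r : ℕ) (m : ℕ → ℤ) (y : ℕ → K) (i j : ℕ) :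
    (motzkinChain r m y).up i j =
      (if j = i + 1 then 1 else 0) + ascendingWeight K⟦X⟧ r m (i + 1) (j + 1) := by
  rcases eq_or_ne j (i + 1) with rfl | hj
  · rw [PairChain.up, ascendingWeight, if_pos ⟨by omega, by omega⟩, if_pos rfl,
      if_neg (by omega), add_zero, Nat.add_sub_cancel_left, Nat.sub_self, pow_zero]
  have hiff : (i < j ∧ ∀ k, i < k → k < j → k ∈ (motzkinChain r m y).vertical) ↔
      i + 1 + 2 ≤ j + 1 ∧ ∀ k, i + 1 < k → k < j + 1 → IsVerticalPair r m k := by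
    refine and_congr (by omega) ⟨fun h k hi hj => ?_, fun h k hi hj => h (k + 1) ?_ ?_⟩
    · obtain ⟨k, rfl⟩ := Nat.exists_eq_succ_of_ne_zero (by omega : k ≠ 0)
      exact h k (by omega) (by omega)
    all_goals omega
  rw [if_neg hj, zero_add, PairChain.up, ascendingWeight, Nat.add_sub_add_right]
  by_cases h : i < j ∧ ∀ k, i < k → k < j → k ∈ (motzkinChain r m y).vertical
  · rw [if_pos h, if_pos (hiff.1 h)]
  · rw [if_neg h, if_neg fun h' => h (hiff.2 h')]

theorem graph_motzkinChain (r : ℕ) (m : ℕ → ℤ) (y : ℕ → K) :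
    (motzkinChain r m y).graph r = gammaGraph r m y := by
  ext1 ⟨i, a⟩
  ext1 ⟨j, b⟩
  cases a <;> cases b <;>
    simp [PairChain.graph, gammaGraph, mem_upperExit_motzkinChain, loop_motzkinChain,
      down_motzkinChain, Fin.ext_iff] <;>
    cases exitSide r m (i + 1) <;> cases exitSide r m (j + 1) <;> grind

theorem compactification_motzkinChain (r : ℕ) (m : ℕ → ℤ) (y : ℕ → K) :
    (motzkinChain r m y).compactification r = compactGraph r m y := by
  ext1 i
  ext1 j
  rw [compactGraph, ← graph_motzkinChain, PairChain.compactification, up_motzkinChain]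
  rcases eq_or_ne i j with rfl | hij
  · simp [PairChain.graph, PairChain.down_of_le, ascendingWeight]
  · simp only [if_neg hij, Fintype.sum_bool, PairChain.graph]
    split_ifs <;> simp_all <;> ring

theorem skeletonWeight_odd_ne_zero {r : ℕ} {R : ℕ → ℤ → K}
    (hR : ∀ (α : ℕ) (n : ℤ), 1 ≤ α → α ≤ r → R α n ≠ 0) (m : ℕ → ℤ) {j : ℕ} (hj : 2 ≤ j)
    (hjr : j ≤ r) : skeletonWeight R m (2 * j - 1) ≠ 0 := by
  have hlam {α : ℕ} (h1 : 1 ≤ α) (hr : α ≤ r) (n : ℤ) : lam R α n ≠ 0 :=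
    div_ne_zero (hR α _ h1 hr) (hR α _ h1 hr)
  rw [skeletonWeight, if_pos (by omega), show (2 * j - 1 + 1) / 2 = j by omega]
  exact div_ne_zero (hlam (by omega) hjr _) (hlam (by omega) (by omega) _)

end Motzkin

theorem mainTheorem4_general {K : Type*} [Field K] (r : ℕ) (m : ℕ → ℤ) (y : ℕ → K)
    (_hy : ∀ j : ℕ, 2 ≤ j → j ≤ r → y (2 * j - 1) ≠ 0) :
    CompactificationPreservesPaths r m y := by
  have hgraph := (motzkinChain r m y).isNilpotent_constantCoeff_graph
    (constantCoeff_motzkinChain_loop r m y) (constantCoeff_motzkinChain_down r m y) r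
  have hcompact := (motzkinChain r m y).isNilpotent_constantCoeff_compactification
    (constantCoeff_motzkinChain_loop r m y) (constantCoeff_motzkinChain_down r m y) r
  have hu := isUnit_one_sub_of_isNilpotent_constantCoeff hgraph
  have hu' := isUnit_one_sub_of_isNilpotent_constantCoeff hcompact
  rw [CompactificationPreservesPaths, ← graph_motzkinChain, ← compactification_motzkinChain]
  exact ⟨hu, hu', (motzkinChain r m y).inv_one_sub_transferMatrix_graph_apply hu hu',
    isPathGenFun_inv_one_sub_transferMatrix hgraph _ _,
    isPathGenFun_inv_one_sub_transferMatrix hcompact _ _⟩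

theorem mainTheorem4 {K : Type*} [Field K] (r : ℕ) (hr : 1 ≤ r)
    (m : ℕ → ℤ) (hm : IsMotzkinPath r m) :
    -- arbitrary skeleton weights for which the weights of the extra edges make sense
    (∀ y : ℕ → K, (∀ j : ℕ, 2 ≤ j → j ≤ r → y (2 * j - 1) ≠ 0) →
      CompactificationPreservesPaths r m y) ∧
    -- the skeleton weights attached to a solution of the `Q`-system
    (∀ R : ℕ → ℤ → K, IsQSystemSolution r R →
      (∀ (α : ℕ) (n : ℤ), 1 ≤ α → α ≤ r → R α n ≠ 0) →
      CompactificationPreservesPaths r m (skeletonWeight R m)) :=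
  ⟨fun y hy => mainTheorem4_general r m y hy,
    fun _ _ hR => mainTheorem4_general r m _ fun _ => skeletonWeight_odd_ne_zero hR m⟩
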